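/- Let $p$ be a prime and let $G$ be an abelian $p$-group, written additively. Define $p^\sigma G$ for ordinals $\sigma$ by $p^0G=G$, $p^{\sigma+1}G=p(p^\sigma G)$ and $p^\sigma G=\bigcap_{\tau<\sigma}p^\tau G$ for limit $\sigma$. For $x\in G$, the height $h(x)$ of $x$ in $G$ is the ordinal $\sigma$ with $x\in p^\sigma G\setminus p^{\sigma+1}G$, and $h(x)=\infty$ if $x\in p^\sigma G$ for every $\sigma$. The Ulm sequence of $x$ is $U(x)=(h(x),h(px),h(p^2x),\dots)$; Ulm sequences are compared entry by entry, with $\infty$ larger than every ordinal. Let $H=\bigoplus_{i=1}^n\langle z_i\rangle$ be a finite subgroup of $G$ with $H\cap p^\omega G=0$, given as an internal direct sum of cyclic subgroups, where $z_i$ has exponent $e_i$, i.e. $z_i$ has order $p^{e_i}$. Then the following are equivalent: 1. Every endomorphism of $H$ extends to an endomorphism of $G$. 2. (a) For all $i,j\in\{1,\dots,n\}$ with $e_j\le e_i$, one has $U(z_i)\le U(z_j)\le U(p^{e_i-e_j}z_i)$; and (b) $H=\bigoplus_{i=1}^n\langle z_i\rangle$ is a valuated direct sum, i.e. $h(x_1+\dots+x_n)=\min\{h(x_1),\dots,h(x_n)\}$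 for all $x_i\in\langle z_i\rangle$ $(1\le i\le n)$, where the heights are taken in $G$. -/

import Mathlib

universe u

noncomputable section

/-- A (possibly infinite) abelian `p`-group, written additively: every element is annihilated by
some power of `p`. -/
def IsAbelianPGroup (p : ℕ) (G : Type u) [AddCommGroup G] : Prop :=
  ∀ x : G, ∃ k : ℕ, p ^ k • x = 0

/-- The transfinite chain `p^σ G`: `p^0 G = G`, `p^(σ+1) G = p (p^σ G)`, and
`p^σ G = ⋂_{τ < σ} p^τ G` for a limit ordinal `σ`. -/
def pPowSubgroup (p : ℕ) (G : Type u) [AddCommGroup G] (σ : Ordinal.{u}) : AddSubgroup G :=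
  Ordinal.limitRecOn (motive := fun _ => AddSubgroup G) σ ⊤
    (fun _ A => A.map (nsmulAddMonoidHom p))
    (fun l _ A => ⨅ (τ : Ordinal.{u}) (h : τ < l), A τ h)

theorem pPowSubgroup_zero (p : ℕ) (G : Type u) [AddCommGroup G] :
    pPowSubgroup p G 0 = ⊤ :=
  Ordinal.limitRecOn_zero ..

theorem pPowSubgroup_add_one (p : ℕ) (G : Type u) [AddCommGroup G] (σ : Ordinal.{u}) :
    pPowSubgroup p G (σ + 1) = (pPowSubgroup p G σ).map (nsmulAddMonoidHom p) :=
  Ordinal.limitRecOn_add_one ..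

theorem pPowSubgroup_limit (p : ℕ) (G : Type u) [AddCommGroup G] (σ : Ordinal.{u})
    (hσ : Order.IsSuccLimit σ) :
    pPowSubgroup p G σ = ⨅ (τ : Ordinal.{u}) (_ : τ < σ), pPowSubgroup p G τ :=
  Ordinal.limitRecOn_limit _ _ _ _ hσ

open Classical in
/-- The height of `x` in `G`: the ordinal `σ` with `x ∈ p^σ G` and `x ∉ p^(σ+1) G`, that is, the
least `σ` with `x ∉ p^(σ+1) G`; it is `∞` (here `⊤`) if `x` lies in every `p^σ G`. -/
def pHeight (p : ℕ) {G : Type u} [AddCommGroup G] (x : G) : WithTop Ordinal.{u} :=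
  if ∃ σ : Ordinal.{u}, x ∉ pPowSubgroup p G (σ + 1) then
    ((sInf {σ : Ordinal.{u} | x ∉ pPowSubgroup p G (σ + 1)} : Ordinal.{u}) :
      WithTop Ordinal.{u})
  else ⊤

/-- The Ulm sequence `U(x) = (h(x), h(px), h(p²x), …)`, where `h` is the height in `G`. The entries
from the exponent of `x` on are `h(0) = ∞`. Ulm sequences are compared pointwise. -/
def ulmSequence (p : ℕ) {G : Type u} [AddCommGroup G] (x : G) : ℕ → WithTop Ordinal.{u} :=
  fun k => pHeight p (p ^ k • x)

/-- `H` is the internal direct sum of the finite family of subgroups `A i`. -/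
def IsInternalDirectSum {G : Type u} [AddCommGroup G] {n : ℕ}
    (H : AddSubgroup G) (A : Fin n → AddSubgroup G) : Prop :=
  iSupIndep A ∧ H = ⨆ i, A i

/-- `H = ⨁ A i` is a valuated direct sum, for the valuation of `H` induced by heights in `G`: the
height in `G` of `∑ x i`, with `x i ∈ A i`, is the minimum of the heights of the `x i` in `G`
(`∞` for the empty family). -/
def IsValuatedDirectSum (p : ℕ) {G : Type u} [AddCommGroup G] {n : ℕ}
    (H : AddSubgroup G) (A : Fin n → AddSubgroup G) : Prop :=
  IsInternalDirectSum H A ∧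
    ∀ x : Fin n → G, (∀ i, x i ∈ A i) →
      pHeight p (∑ i, x i) = Finset.univ.inf fun i => pHeight p (x i)

/-- Every endomorphism of the subgroup `H` extends to an endomorphism of `G`. -/
def EndomorphismsExtend {G : Type u} [AddCommGroup G] (H : AddSubgroup G) : Prop :=
  ∀ f : H →+ H, ∃ g : G →+ G, ∀ x : H, g (x : G) = (f x : G)

end

/-! Endomorphisms of `G` never lower heights, since each `p^σ G` is fully invariant. So if
endomorphisms of `H` extend, extending the projections makes the sum valuated, and extending the
maps that send `z i` to a suitable element and kill the other generators gives the Ulm inequalities.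
Conversely, the Ulm inequalities and the valuated sum force every endomorphism of `H` to preserve or
raise heights (`pHeight_le_pHeight_apply`). As `H` is finite and meets `p^ω G` trivially, it already
meets some `p^N G` trivially with `N` finite. A Zorn argument on additive relations in `G × G`,
starting from the graph, then yields an extension that kills `p^N G`
(`exists_extension_of_forall_mem_pPowSubgroup`). -/

section Heights

/-! ### Heights and Ulm sequences. -/

variable {p : ℕ} {G : Type u} [AddCommGroup G]

theorem pPowSubgroup_succ_le (σ : Ordinal.{u}) :
    pPowSubgroup p G (σ + 1) ≤ pPowSubgroup p G σ := by
  rw [pPowSubgroup_add_one]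
  rintro _ ⟨y, hy, rfl⟩
  exact nsmul_mem hy p

theorem pPowSubgroup_antitone : Antitone (pPowSubgroup p G) := by
  intro τ σ h
  induction σ using Ordinal.limitRecOn with
  | zero => rw [nonpos_iff_eq_zero.mp h]
  | add_one σ ih =>
    rcases h.lt_or_eq with h | rfl
    · exact (pPowSubgroup_succ_le σ).trans (ih (Order.lt_add_one_iff.mp h))
    · exact le_rfl
  | limit σ hσ _ =>
    rcases h.lt_or_eq with h | rfl
    · rw [pPowSubgroup_limit p G σ hσ]
      exact iInf₂_le τ h
    · exact le_rfl

/-- An element can first drop out of the chain only at a successor stage, which is why `pHeight`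
tests successors alone. -/
theorem mem_pPowSubgroup_of_forall_lt {x : G} {σ : Ordinal.{u}}
    (h : ∀ τ < σ, x ∈ pPowSubgroup p G (τ + 1)) : x ∈ pPowSubgroup p G σ := by
  induction σ using Ordinal.limitRecOn with
  | zero => rw [pPowSubgroup_zero]; trivial
  | add_one σ _ => exact h σ (Order.lt_add_one_iff.mpr le_rfl)
  | limit σ hσ _ =>
    rw [pPowSubgroup_limit p G σ hσ]
    simp only [AddSubgroup.mem_iInf]
    exact fun τ hτ => pPowSubgroup_succ_le τ (h τ hτ)

theorem coe_le_pHeight_iff {x : G} {σ : Ordinal.{u}} :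
    (σ : WithTop Ordinal.{u}) ≤ pHeight p x ↔ x ∈ pPowSubgroup p G σ := by
  unfold pHeight
  split_ifs with hx
  · rw [WithTop.coe_le_coe]
    constructor
    · intro h
      refine mem_pPowSubgroup_of_forall_lt fun τ hτ => ?_
      by_contra hn
      exact absurd (csInf_le' (s := {σ | x ∉ pPowSubgroup p G (σ + 1)}) hn) (hτ.trans_le h).not_ge
    · intro h
      refine le_csInf hx fun τ hτ => ?_
      by_contra! hlt
      exact hτ (pPowSubgroup_antitone (Order.add_one_le_of_lt hlt) h)
  · push Not at hx
    simpa using mem_pPowSubgroup_of_forall_lt fun τ _ => hx τ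

theorem WithTop.le_of_forall_ordinal_le {a b : WithTop Ordinal.{u}}
    (h : ∀ σ : Ordinal.{u}, (σ : WithTop Ordinal.{u}) ≤ a → (σ : WithTop Ordinal.{u}) ≤ b) :
    a ≤ b := by
  by_contra! hlt
  obtain ⟨σ, rfl⟩ := WithTop.ne_top_iff_exists.mp hlt.ne_top
  have ha : ((σ + 1 : Ordinal.{u}) : WithTop Ordinal.{u}) ≤ a := by
    induction a using WithTop.recTopCoe with
    | top => exact le_top
    | coe τ => exact WithTop.coe_le_coe.mpr (Order.add_one_le_of_lt (WithTop.coe_lt_coe.mp hlt))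
  exact (Order.lt_add_one_iff.mpr le_rfl).not_ge (WithTop.coe_le_coe.mp (h _ ha))

theorem pHeight_le_pHeight_iff {x y : G} :
    pHeight p x ≤ pHeight p y ↔
      ∀ σ : Ordinal.{u}, x ∈ pPowSubgroup p G σ → y ∈ pPowSubgroup p G σ := by
  simp only [← coe_le_pHeight_iff]
  exact ⟨fun h σ hσ => hσ.trans h, WithTop.le_of_forall_ordinal_le⟩

/-- The subgroups `p^σ G` are fully invariant. -/
theorem map_mem_pPowSubgroup (g : G →+ G) {x : G} {σ : Ordinal.{u}}
    (hx : x ∈ pPowSubgroup p G σ) : g x ∈ pPowSubgroup p G σ := by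
  induction σ using Ordinal.limitRecOn generalizing x with
  | zero => rw [pPowSubgroup_zero]; trivial
  | add_one σ ih =>
    rw [pPowSubgroup_add_one] at hx ⊢
    obtain ⟨y, hy, rfl⟩ := hx
    exact ⟨g y, ih hy, by simp⟩
  | limit σ hσ ih =>
    rw [pPowSubgroup_limit p G σ hσ] at hx ⊢
    simp only [AddSubgroup.mem_iInf] at hx ⊢
    exact fun τ hτ => ih τ hτ (hx τ hτ)

theorem pHeight_le_pHeight_map (g : G →+ G) (x : G) : pHeight p x ≤ pHeight p (g x) :=
  pHeight_le_pHeight_iff.mpr fun _ => map_mem_pPowSubgroup g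

theorem ulmSequence_le_map (g : G →+ G) (x : G) : ulmSequence p x ≤ ulmSequence p (g x) := by
  intro k
  simpa only [ulmSequence, map_nsmul] using pHeight_le_pHeight_map g (p ^ k • x)

theorem pHeight_le_zsmul (m : ℤ) (x : G) : pHeight p x ≤ pHeight p (m • x) :=
  pHeight_le_pHeight_iff.mpr fun _ h => zsmul_mem h m

theorem inf_pHeight_le_sum {ι : Type*} (s : Finset ι) (x : ι → G) :
    (s.inf fun i => pHeight p (x i)) ≤ pHeight p (∑ i ∈ s, x i) := by
  refine WithTop.le_of_forall_ordinal_le fun σ hσ => ?_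
  rw [Finset.le_inf_iff] at hσ
  exact coe_le_pHeight_iff.mpr (sum_mem fun i hi => coe_le_pHeight_iff.mp (hσ i hi))

/-- Multiplication by an integer prime to `p` does not change heights in a `p`-group. -/
theorem pHeight_zsmul_of_isCoprime (hG : IsAbelianPGroup p G) {m : ℤ} (hm : IsCoprime m (p : ℤ))
    (x : G) : pHeight p (m • x) = pHeight p x := by
  refine le_antisymm ?_ (pHeight_le_zsmul m x)
  obtain ⟨k, hk⟩ := hG x
  obtain ⟨a, b, hab⟩ := hm.pow_right (n := k)
  have : x = a • m • x := by
    have h := congrArg (fun t : ℤ => t • x) hab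
    have h0 : ((p : ℤ) ^ k) • x = 0 := by exact_mod_cast hk
    simpa only [add_smul, one_smul, mul_smul, h0, smul_zero, add_zero] using h.symm
  conv_rhs => rw [this]
  exact pHeight_le_zsmul a _

/-- Write `m = p^k c` with `c` prime to `p`: the factor `c` does not affect heights, so entry `k` of
the Ulm sequences decides. -/
theorem pHeight_zsmul_le_of_ulmSequence_le (hp : p.Prime) (hG : IsAbelianPGroup p G) {x y : G}
    (h : ulmSequence p x ≤ ulmSequence p y) (m : ℤ) :
    pHeight p (m • x) ≤ pHeight p (m • y) := by
  rcases eq_or_ne m 0 with rfl | hm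
  · simp
  obtain ⟨k, c, hc, rfl⟩ : ∃ (k : ℕ) (c : ℤ), ¬ (p : ℤ) ∣ c ∧ m = (p : ℤ) ^ k * c := by
    have hf : FiniteMultiplicity (p : ℤ) m := Int.finiteMultiplicity_iff.mpr
      ⟨by simpa using hp.ne_one, hm⟩
    obtain ⟨c, h1, h2⟩ := hf.exists_eq_pow_mul_and_not_dvd
    exact ⟨_, c, h2, h1⟩
  have hcop : IsCoprime c (p : ℤ) :=
    ((Nat.prime_iff_prime_int.mp hp).coprime_iff_not_dvd.mpr hc).symm
  have key : ∀ w : G, pHeight p (((p : ℤ) ^ k * c) • w) = pHeight p (p ^ k • w) := by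
    intro w
    rw [mul_comm, mul_smul, pHeight_zsmul_of_isCoprime hG hcop]
    exact_mod_cast rfl
  rw [key, key]
  exact h k

end Heights

/-! ### Extending height-increasing maps. -/

section Extension

variable {p : ℕ} {G : Type u} [AddCommGroup G]

/-- A subgroup `S` of `G × G`, seen as an additive relation, is `N`-height-increasing if it does
not decrease heights below `N` and relates the elements of `p^N G` to `0` only. -/
def IsHeightIncreasing (p : ℕ) {G : Type u} [AddCommGroup G] (N : ℕ) (S : AddSubgroup (G × G)) :
    Prop :=
  ∀ s ∈ S, (∀ k < N, s.1 ∈ pPowSubgroup p G (k : ℕ) → s.2 ∈ pPowSubgroup p G (k : ℕ)) ∧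
    (s.1 ∈ pPowSubgroup p G (N : ℕ) → s.2 = 0)

theorem exists_maximal_isHeightIncreasing {N : ℕ} {S : AddSubgroup (G × G)}
    (hS : IsHeightIncreasing p N S) :
    ∃ T, S ≤ T ∧ Maximal (IsHeightIncreasing p N) T := by
  refine zorn_le_nonempty₀ {T | IsHeightIncreasing p N T} (fun c hcs hc y hy => ?_) S hS
  refine ⟨sSup c, fun s hs => ?_, fun _ => le_sSup⟩
  obtain ⟨T, hT, hsT⟩ := (AddSubgroup.mem_sSup_of_directedOn ⟨y, hy⟩ hc.directedOn).mp hs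
  exact hcs hT s hsT

/-- One-step extension: adjoin `(a, b)` where `p • b = c` and `b` is at least as high as a best
representative `a` of its coset modulo the domain. -/
theorem IsHeightIncreasing.exists_extension (hp : p.Prime) {N : ℕ} {S : AddSubgroup (G × G)}
    (hS : IsHeightIncreasing p N S) {a : G} (ha : ∀ b, (a, b) ∉ S) {c : G} (hc : (p • a, c) ∈ S) :
    ∃ T, S < T ∧ IsHeightIncreasing p N T := by
  classical
  -- choose a representative of maximal height in the coset of `a`
  obtain ⟨a, k, ha, ⟨c, hc⟩, hkN, hk, hmax⟩ : ∃ (a : G) (k : ℕ), (∀ b, (a, b) ∉ S) ∧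
      (∃ c, (p • a, c) ∈ S) ∧ k ≤ N ∧ a ∈ pPowSubgroup p G (k : ℕ) ∧
      ∀ s ∈ S, ∀ j ≤ N, a + s.1 ∈ pPowSubgroup p G (j : ℕ) → j ≤ k := by
    let P : ℕ → Prop := fun k => ∃ s ∈ S, a + s.1 ∈ pPowSubgroup p G (k : ℕ)
    have h0 : P 0 := ⟨0, zero_mem _, by rw [Nat.cast_zero, pPowSubgroup_zero]; trivial⟩
    obtain ⟨s, hs, hks⟩ : P (Nat.findGreatest P N) := Nat.findGreatest_spec (Nat.zero_le N) h0
    refine ⟨a + s.1, Nat.findGreatest P N, fun b hb => ha (b - s.2) ?_, ⟨c + p • s.2, ?_⟩,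
      Nat.findGreatest_le N, hks, fun t ht j hj hjt => Nat.le_findGreatest hj ⟨s + t, ?_, ?_⟩⟩
    · simpa [Prod.sub_def] using sub_mem hb hs
    · simpa [Prod.add_def] using add_mem hc (nsmul_mem hs p)
    · exact add_mem hs ht
    · simpa [add_assoc] using hjt
  -- Since `p • a` lies in `p^(k+1) G`, so does `c`, and it can be divided by `p` inside `p^k G`.
  -- Heights are capped at `N`; at the cap `c = 0` and `b = 0` is forced.
  obtain ⟨b, hbc, hb, hbN⟩ : ∃ b, p • b = c ∧ (k < N → b ∈ pPowSubgroup p G (k : ℕ)) ∧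
      (k = N → b = 0) := by
    have hpa : p • a ∈ pPowSubgroup p G ((k + 1 : ℕ) : Ordinal.{u}) := by
      rw [Nat.cast_succ, pPowSubgroup_add_one]
      exact ⟨a, hk, rfl⟩
    rcases hkN.lt_or_eq with hlt | rfl
    · have hcm : c ∈ pPowSubgroup p G ((k + 1 : ℕ) : Ordinal.{u}) := by
        rcases (Nat.succ_le_of_lt hlt).lt_or_eq with h | h
        · exact (hS _ hc).1 _ h hpa
        · have := (hS _ hc).2 (by rw [← h]; exact hpa)
          dsimp only at this
          rw [this]
          exact zero_mem _
      rw [Nat.cast_succ, pPowSubgroup_add_one] at hcm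
      obtain ⟨b, hb, hbc⟩ := hcm
      exact ⟨b, hbc, fun _ => hb, fun h => absurd h hlt.ne⟩
    · have hc0 : c = 0 := (hS _ hc).2 (nsmul_mem hk p)
      exact ⟨0, by simp [hc0], fun h => absurd h (lt_irrefl _), fun _ => rfl⟩
  refine ⟨S ⊔ AddSubgroup.zmultiples (a, b), lt_of_le_of_ne le_sup_left fun h => ha b ?_, ?_⟩
  · rw [h]
    exact AddSubgroup.mem_sup_right (AddSubgroup.mem_zmultiples _)
  intro t ht
  obtain ⟨s, hs, _, ⟨m, rfl⟩, rfl⟩ := AddSubgroup.mem_sup.mp ht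
  by_cases hm : (p : ℤ) ∣ m
  · obtain ⟨d, rfl⟩ := hm
    apply hS
    refine add_mem hs ?_
    have : ((p : ℤ) * d) • (a, b) = d • (p • a, c) := by
      rw [mul_comm, mul_smul, natCast_zsmul, ← hbc]; rfl
    change ((p : ℤ) * d) • (a, b) ∈ S
    rw [this]
    exact zsmul_mem hc d
  -- By Bézout, `u • (s.1 + m • a)` is `a` plus an element of the domain, so maximality of `k`
  -- bounds the height of `s.1 + m • a`.
  · obtain ⟨u, v, huv⟩ : IsCoprime m (p : ℤ) :=
      ((Nat.prime_iff_prime_int.mp hp).coprime_iff_not_dvd.mpr hm).symm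
    have hle : ∀ j ≤ N, s.1 + m • a ∈ pPowSubgroup p G (j : ℕ) → j ≤ k := by
      intro j hj h
      refine hmax (u • s - v • (p • a, c)) (sub_mem (zsmul_mem hs u) (zsmul_mem hc v)) j hj ?_
      have h1 := zsmul_mem h u
      have h2 : a = u • m • a + v • p • a := by
        rw [← natCast_zsmul, smul_smul, smul_smul, ← add_smul, huv, one_smul]
      convert h1 using 1
      simp only [Prod.fst_sub, Prod.smul_fst]
      nth_rewrite 1 [h2]
      rw [smul_add]
      abel
    have hsplit : ∀ j ≤ k, s.1 + m • a ∈ pPowSubgroup p G (j : ℕ) →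
        s.1 ∈ pPowSubgroup p G (j : ℕ) := by
      intro j hj h
      have : m • a ∈ pPowSubgroup p G (j : ℕ) :=
        zsmul_mem (pPowSubgroup_antitone (Nat.cast_le.mpr hj) hk) m
      simpa using sub_mem h this
    constructor
    · intro j hj h
      have hjk := hle j hj.le h
      refine add_mem ((hS s hs).1 j hj (hsplit j hjk h)) (zsmul_mem ?_ m)
      rcases hkN.lt_or_eq with hlt | heq
      · exact pPowSubgroup_antitone (Nat.cast_le.mpr hjk) (hb hlt)
      · rw [hbN heq]; exact zero_mem _
    · intro h
      have hNk := le_antisymm hkN (hle N le_rfl h)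
      have h1 := (hS s hs).2 (hsplit N hNk.ge h)
      simp [h1, hbN hNk]

theorem Maximal.exists_mem_of_isHeightIncreasing (hp : p.Prime) (hG : IsAbelianPGroup p G) {N : ℕ}
    {S : AddSubgroup (G × G)} (hS : Maximal (IsHeightIncreasing p N) S) (x : G) :
    ∃ y, (x, y) ∈ S := by
  obtain ⟨k, hk⟩ := hG x
  have key : ∀ k : ℕ, (∃ y, (p ^ k • x, y) ∈ S) → ∃ y, (x, y) ∈ S := by
    intro k
    induction k with
    | zero => simp
    | succ k ih =>
      rintro ⟨c, hc⟩
      apply ih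
      by_contra! ha
      obtain ⟨T, hST, hT⟩ := hS.1.exists_extension hp ha (c := c)
        (by rwa [smul_smul, ← pow_succ'])
      exact hST.not_ge (hS.2 hT hST.le)
  exact key k ⟨0, by rw [hk]; exact zero_mem S⟩

/-- A homomorphism from a subgroup `H` of `G` with `H ∩ p^N G = 0` which does not decrease
heights extends to an endomorphism of `G`. -/
theorem exists_extension_of_forall_mem_pPowSubgroup (hp : p.Prime) (hG : IsAbelianPGroup p G)
    {H : AddSubgroup G} {N : ℕ} (hN : H ⊓ pPowSubgroup p G (N : ℕ) = ⊥) (f : H →+ G)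
    (hf : ∀ (x : H) (k : ℕ), (x : G) ∈ pPowSubgroup p G (k : ℕ) →
      f x ∈ pPowSubgroup p G (k : ℕ)) :
    ∃ g : G →+ G, ∀ x : H, g x = f x := by
  have h0 : IsHeightIncreasing p N ((H.subtype.prod f).range) := by
    rintro _ ⟨x, rfl⟩
    refine ⟨fun k _ => hf x k, fun hx => ?_⟩
    have hx0 : (x : G) ∈ H ⊓ pPowSubgroup p G (N : ℕ) := ⟨x.2, hx⟩
    rw [hN, AddSubgroup.mem_bot, ZeroMemClass.coe_eq_zero] at hx0
    simp [hx0]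
  obtain ⟨S, hle, hS⟩ := exists_maximal_isHeightIncreasing h0
  choose g hg using hS.exists_mem_of_isHeightIncreasing hp hG
  -- The relation is single-valued because `0 ∈ p^N G` is related only to `0`.
  have huniq : ∀ {x y z : G}, (x, y) ∈ S → (x, z) ∈ S → y = z := by
    intro x y z hy hz
    have := (hS.1 _ (sub_mem hy hz)).2 (by simp [zero_mem])
    simpa [sub_eq_zero] using this
  refine ⟨AddMonoidHom.mk' g fun x y => huniq (hg _) (add_mem (hg x) (hg y)), fun x => ?_⟩
  exact huniq (hg x) (hle ⟨x, rfl⟩)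

end Extension

/-! ### Direct sums of cyclic groups and the two implications. -/

section DirectSums

variable {p : ℕ} {G : Type u} [AddCommGroup G]

theorem AddSubgroup.exists_sum_eq_of_mem_iSup {n : ℕ} {A : Fin n → AddSubgroup G} {x : G}
    (hx : x ∈ ⨆ i, A i) : ∃ c : Fin n → G, (∀ i, c i ∈ A i) ∧ ∑ i, c i = x := by
  classical
  induction hx using AddSubgroup.iSup_induction' with
  | hp i x hx =>
    refine ⟨Pi.single i x, fun j => ?_, by simp⟩
    rcases eq_or_ne j i with rfl | h
    · simpa using hx
    · simp [h, zero_mem]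
  | h1 => exact ⟨0, fun i => zero_mem _, by simp⟩
  | hadd x y _ _ ihx ihy =>
    obtain ⟨c, hc, rfl⟩ := ihx
    obtain ⟨d, hd, rfl⟩ := ihy
    exact ⟨c + d, fun i => add_mem (hc i) (hd i), by simp [Finset.sum_add_distrib]⟩

/-- Homomorphisms out of an internal direct sum can be prescribed on the summands. -/
theorem IsInternalDirectSum.exists_hom {n : ℕ} {H : AddSubgroup G} {A : Fin n → AddSubgroup G}
    (hH : IsInternalDirectSum H A) {M : Type*} [AddCommGroup M] (g : ∀ i, A i →+ M) :
    ∃ f : H →+ M, ∀ i (a : A i) (h : (a : G) ∈ H), f ⟨a, h⟩ = g i a := by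
  classical
  obtain ⟨hind, rfl⟩ := hH
  let φ : (Π₀ i, A i) →+ G := DFinsupp.sumAddHom fun i => (A i).subtype
  have hmem : ∀ x, φ x ∈ ⨆ i, A i := fun x => by
    rw [DFinsupp.sumAddHom_apply]
    exact sum_mem fun i _ => AddSubgroup.mem_iSup_of_mem i (x i).2
  have hinj : Function.Injective φ := hind.dfinsuppSumAddHom_injective
  have hbij : Function.Bijective (φ.codRestrict (⨆ i, A i) hmem) := by
    refine ⟨fun x y h => hinj (congrArg Subtype.val h), fun x => ?_⟩
    obtain ⟨c, hc, hx⟩ := AddSubgroup.exists_sum_eq_of_mem_iSup x.2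
    refine ⟨∑ i, DFinsupp.single i ⟨c i, hc i⟩, Subtype.ext ?_⟩
    simp [φ, ← hx]
  let ψ := AddEquiv.ofBijective _ hbij
  refine ⟨(DFinsupp.sumAddHom g).comp ψ.symm.toAddMonoidHom, fun i a h => ?_⟩
  have : ψ.symm ⟨a, h⟩ = DFinsupp.single i a := by
    rw [AddEquiv.symm_apply_eq]
    exact Subtype.ext (by simp [ψ, φ])
  simp [this]

theorem IsInternalDirectSum.le {n : ℕ} {H : AddSubgroup G} {A : Fin n → AddSubgroup G}
    (hH : IsInternalDirectSum H A) (i : Fin n) : A i ≤ H :=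
  hH.2 ▸ le_iSup A i

theorem IsInternalDirectSum.eq_zero_of_sum_eq_zero {n : ℕ} {H : AddSubgroup G}
    {A : Fin n → AddSubgroup G} (hH : IsInternalDirectSum H A) {x : Fin n → G}
    (hx : ∀ i, x i ∈ A i) (h : ∑ i, x i = 0) : x = 0 := by
  classical
  funext i
  refine AddSubgroup.disjoint_def.mp (hH.1 i) (hx i) ?_
  rw [← Finset.add_sum_erase _ _ (Finset.mem_univ i), add_eq_zero_iff_eq_neg] at h
  rw [h]
  exact neg_mem (sum_mem fun j hj =>
    AddSubgroup.mem_iSup_of_mem j (AddSubgroup.mem_iSup_of_mem (Finset.ne_of_mem_erase hj) (hx j)))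

theorem EndomorphismsExtend.exists_extension {n : ℕ} {H : AddSubgroup G}
    {A : Fin n → AddSubgroup G} (hext : EndomorphismsExtend H) (hH : IsInternalDirectSum H A)
    (g : ∀ i, A i →+ G) (hg : ∀ i a, g i a ∈ H) :
    ∃ f : G →+ G, ∀ i (a : A i), f a = g i a := by
  obtain ⟨f, hf⟩ := hH.exists_hom fun i => (g i).codRestrict H (hg i)
  obtain ⟨F, hF⟩ := hext f
  refine ⟨F, fun i a => ?_⟩
  have := hF ⟨a, hH.le i a.2⟩
  rw [hf] at this
  exact this

/-- The projection onto `A i` extends to `G`, so each component is at least as high as the sum. -/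
theorem EndomorphismsExtend.isValuatedDirectSum {n : ℕ} {H : AddSubgroup G}
    {A : Fin n → AddSubgroup G} (hext : EndomorphismsExtend H) (hH : IsInternalDirectSum H A) :
    IsValuatedDirectSum p H A := by
  classical
  refine ⟨hH, fun x hx => le_antisymm (Finset.le_inf fun i _ => ?_) (inf_pHeight_le_sum _ x)⟩
  obtain ⟨f, hf⟩ := hext.exists_extension hH (fun j => if j = i then (A j).subtype else 0) (by
    intro j a
    split_ifs
    · exact hH.le j a.2
    · exact zero_mem H)
  have : f (∑ j, x j) = x i := by
    rw [map_sum, Finset.sum_eq_single i]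
    · simpa using hf i ⟨x i, hx i⟩
    · intro j _ hj
      simpa [hj] using hf j ⟨x j, hx j⟩
    · simp
  exact (pHeight_le_pHeight_map f _).trans_eq (congrArg _ this)

theorem EndomorphismsExtend.ulmSequence_le {n : ℕ} {H : AddSubgroup G} {z : Fin n → G}
    (hext : EndomorphismsExtend H)
    (hH : IsInternalDirectSum H fun i => AddSubgroup.zmultiples (z i)) (i : Fin n) {y : G}
    (hy : y ∈ H) (hord : addOrderOf y ∣ addOrderOf (z i)) :
    ulmSequence p (z i) ≤ ulmSequence p y := by
  classical
  let w : AddSubgroup.zmultiples (z i) := ⟨z i, AddSubgroup.mem_zmultiples _⟩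
  have hw : ∀ x, x ∈ AddSubgroup.zmultiples w := by
    rintro ⟨_, m, rfl⟩
    exact ⟨m, rfl⟩
  have hord' : addOrderOf y ∣ addOrderOf w := by
    rwa [← AddSubgroup.addOrderOf_coe]
  let φ : AddSubgroup.zmultiples (z i) →+ G := addMonoidHomOfForallMemZMultiples hw hord'
  have hφ : φ w = y := addMonoidHomOfForallMemZMultiples_apply_gen hw hord'
  obtain ⟨f, hf⟩ := hext.exists_extension hH
    (fun j => if h : j = i then h ▸ φ else 0) (by
      intro j a
      split_ifs with h
      · subst h
        obtain ⟨m, rfl⟩ := hw a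
        simpa [hφ] using zsmul_mem hy m
      · exact zero_mem H)
  have : f (z i) = y := by simpa [hφ] using hf i w
  exact this ▸ ulmSequence_le_map f (z i)

/-- Each nonzero element of `H` leaves the chain at a finite stage; finiteness of `H` bounds these
stages. -/
theorem exists_nat_inf_pPowSubgroup_eq_bot {H : AddSubgroup G} [Finite H]
    (hω : H ⊓ pPowSubgroup p G Ordinal.omega0 = ⊥) :
    ∃ N : ℕ, H ⊓ pPowSubgroup p G (N : ℕ) = ⊥ := by
  have h : ∀ x : H, ∃ k : ℕ, (x : G) ∈ pPowSubgroup p G (k : ℕ) → x = 0 := by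
    intro x
    by_contra! hx
    have hmem : (x : G) ∈ pPowSubgroup p G Ordinal.omega0 := by
      refine mem_pPowSubgroup_of_forall_lt fun τ hτ => ?_
      obtain ⟨k, rfl⟩ := Ordinal.lt_omega0.mp hτ
      exact_mod_cast (hx (k + 1)).1
    have h0 : (x : G) ∈ H ⊓ pPowSubgroup p G Ordinal.omega0 := ⟨x.2, hmem⟩
    rw [hω, AddSubgroup.mem_bot, ZeroMemClass.coe_eq_zero] at h0
    exact (hx 0).2 h0
  choose k hk using h
  obtain ⟨N, hN⟩ := (Set.finite_range k).bddAbove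
  refine ⟨N, (AddSubgroup.eq_bot_iff_forall _).mpr fun x hx => ?_⟩
  have := hk ⟨x, hx.1⟩
    (pPowSubgroup_antitone (Nat.cast_le.mpr (hN (Set.mem_range_self _))) hx.2)
  exact congrArg Subtype.val this

theorem finite_iSup_zmultiples (hp : p.Prime) (hG : IsAbelianPGroup p G) {n : ℕ} (z : Fin n → G) :
    Finite (⨆ i, AddSubgroup.zmultiples (z i) : AddSubgroup G) := by
  have : ∀ i, Finite (AddSubgroup.zmultiples (z i)) := fun i => by
    rw [← SetLike.coe_sort_coe, Set.finite_coe_iff, finite_zmultiples, isOfFinAddOrder_iff_nsmul_eq_zero]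
    obtain ⟨k, hk⟩ := hG (z i)
    exact ⟨p ^ k, pow_pos hp.pos k, hk⟩
  have hfin : (Set.range fun c : ∀ i, AddSubgroup.zmultiples (z i) => ∑ i, (c i : G)).Finite :=
    Set.finite_range _
  refine (hfin.subset fun x hx => ?_).to_subtype
  obtain ⟨c, hc, hx⟩ := AddSubgroup.exists_sum_eq_of_mem_iSup hx
  exact ⟨fun i => ⟨c i, hc i⟩, hx⟩

theorem exists_zsmul_eq_of_pow_smul_eq_zero (hp : p.Prime) {a b : ℕ} (hab : a ≤ b) {z y : G}
    (hz : addOrderOf z = p ^ b) (hy : y ∈ AddSubgroup.zmultiples z) (h : p ^ a • y = 0) :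
    ∃ c : ℤ, y = c • p ^ (b - a) • z := by
  obtain ⟨m, rfl⟩ := hy
  have h1 : ((p ^ a : ℕ) * m : ℤ) • z = 0 := by
    rw [mul_smul, natCast_zsmul]; exact h
  rw [← addOrderOf_dvd_iff_zsmul_eq_zero, hz] at h1
  obtain ⟨c, rfl⟩ : ((p ^ (b - a) : ℕ) : ℤ) ∣ m := by
    rw [← Nat.add_sub_of_le hab, pow_add, Nat.cast_mul] at h1
    exact Int.dvd_of_mul_dvd_mul_left (by exact_mod_cast (pow_pos hp.pos a).ne') h1
  refine ⟨c, ?_⟩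
  change (((p ^ (b - a) : ℕ) : ℤ) * c) • z = _
  rw [mul_comm, mul_smul, natCast_zsmul]

theorem pHeight_le_pHeight_apply (hp : p.Prime) (hG : IsAbelianPGroup p G) {H : AddSubgroup G}
    {n : ℕ} {z : Fin n → G} {e : Fin n → ℕ} (hz : ∀ i, addOrderOf (z i) = p ^ e i)
    (hU : ∀ i j, e j ≤ e i → ulmSequence p (z i) ≤ ulmSequence p (z j) ∧
      ulmSequence p (z j) ≤ ulmSequence p (p ^ (e i - e j) • z i))
    (hH : IsValuatedDirectSum p H fun i => AddSubgroup.zmultiples (z i)) (f : H →+ H) (x : H) :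
    pHeight p (x : G) ≤ pHeight p (f x : G) := by
  have hmem : ∀ i, z i ∈ H := fun i => hH.1.le i (AddSubgroup.mem_zmultiples _)
  have hgen : ∀ i (m : ℤ), pHeight p (m • z i) ≤ pHeight p (m • (f ⟨z i, hmem i⟩ : G)) := by
    intro i m
    obtain ⟨y, hy, hsum⟩ := AddSubgroup.exists_sum_eq_of_mem_iSup
      (hH.1.2.le (f ⟨z i, hmem i⟩).2)
    have hfz : p ^ e i • (f ⟨z i, hmem i⟩ : G) = 0 := by
      have h0 : p ^ e i • (⟨z i, hmem i⟩ : H) = 0 :=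
        Subtype.ext (by simpa [hz i] using addOrderOf_nsmul_eq_zero (z i))
      rw [← AddSubgroup.coe_nsmul, ← map_nsmul, h0, map_zero, ZeroMemClass.coe_zero]
    have hy0 : ∀ j, p ^ e i • y j = 0 := by
      refine congrFun (hH.1.eq_zero_of_sum_eq_zero (fun j => nsmul_mem (hy j) (p ^ e i)) ?_)
      rw [← Finset.smul_sum, hsum, hfz]
    rw [← hsum, Finset.smul_sum]
    refine le_trans (Finset.le_inf fun j _ => ?_) (inf_pHeight_le_sum _ _)
    -- If `e j ≤ e i`, any multiple of `z j` is covered by the first Ulm inequality. Otherwise `p^(e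
    -- i)` kills `y j`, which is thus a multiple of `p^(e j - e i) • z j`, and the second applies.
    rcases le_total (e j) (e i) with hji | hij
    · obtain ⟨c, hc⟩ := hy j
      rw [← hc]
      simp only
      rw [smul_comm]
      exact (pHeight_zsmul_le_of_ulmSequence_le hp hG (hU i j hji).1 m).trans
        (pHeight_le_zsmul c _)
    · obtain ⟨c, hc⟩ := exists_zsmul_eq_of_pow_smul_eq_zero hp hij (hz j) (hy j) (hy0 j)
      rw [hc, smul_comm]
      exact (pHeight_zsmul_le_of_ulmSequence_le hp hG (hU j i hij).2 m).trans
        (pHeight_le_zsmul c _)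
  obtain ⟨c, hc, hx⟩ := AddSubgroup.exists_sum_eq_of_mem_iSup (hH.1.2.le x.2)
  have hxf : (f x : G) = ∑ i, (f ⟨c i, hH.1.le i (hc i)⟩ : G) := by
    have : x = ∑ i, (⟨c i, hH.1.le i (hc i)⟩ : H) := Subtype.ext (by simp [hx])
    conv_lhs => rw [this]
    simp
  -- The valuated sum is needed only for the height of `x`; on the image side the general bound
  -- `inf_pHeight_le_sum` suffices.
  rw [hxf, ← hx, hH.2 c hc]
  refine le_trans (Finset.inf_mono_fun fun i _ => ?_) (inf_pHeight_le_sum _ _)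
  obtain ⟨m, hm⟩ := hc i
  have hm' : (⟨c i, hH.1.le i (hc i)⟩ : H) = m • ⟨z i, hmem i⟩ := Subtype.ext hm.symm
  rw [hm', ← hm, map_zsmul]
  exact hgen i m

end DirectSums

theorem mainTheorem3 (p : ℕ) (hp : p.Prime) {G : Type u} [AddCommGroup G]
    (hG : IsAbelianPGroup p G) (H : AddSubgroup G) (n : ℕ) (z : Fin n → G) (e : Fin n → ℕ)
    (hz : ∀ i, addOrderOf (z i) = p ^ e i)
    (hH : IsInternalDirectSum H fun i => AddSubgroup.zmultiples (z i))
    (hω : H ⊓ pPowSubgroup p G Ordinal.omega0 = ⊥) :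
    EndomorphismsExtend H ↔
      ((∀ i j, e j ≤ e i →
          ulmSequence p (z i) ≤ ulmSequence p (z j) ∧
            ulmSequence p (z j) ≤ ulmSequence p (p ^ (e i - e j) • z i)) ∧
        IsValuatedDirectSum p H fun i => AddSubgroup.zmultiples (z i)) := by
  have hmem : ∀ i, z i ∈ H := fun i => hH.le i (AddSubgroup.mem_zmultiples _)
  constructor
  · refine fun hext => ⟨fun i j hji => ⟨?_, ?_⟩, hext.isValuatedDirectSum hH⟩
    · refine hext.ulmSequence_le hH i (hmem j) ?_
      rw [hz, hz]
      exact pow_dvd_pow p hji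
    · refine hext.ulmSequence_le hH j (nsmul_mem (hmem i) _) ?_
      rw [hz, addOrderOf_dvd_iff_nsmul_eq_zero, smul_smul, ← pow_add, Nat.add_sub_of_le hji,
        ← hz i, addOrderOf_nsmul_eq_zero]
  · rintro ⟨hU, hval⟩ f
    have : Finite H := hH.2 ▸ finite_iSup_zmultiples hp hG z
    obtain ⟨N, hN⟩ := exists_nat_inf_pPowSubgroup_eq_bot hω
    exact exists_extension_of_forall_mem_pPowSubgroup hp hG hN (H.subtype.comp f) fun x k hx =>
      pHeight_le_pHeight_iff.mp (pHeight_le_pHeight_apply hp hG hz hU hval f x) _ hx
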